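/- Let $q$ be a prime power with $q\equiv 3 \pmod 4$, let $\mathbb{F}_q$ and $\mathbb{F}_{q^2}$ be the fields of $q$ and $q^2$ elements, and let $N(z)=z^{q+1}$ be the norm map $\mathbb{F}_{q^2}\to\mathbb{F}_q$. All characters are complex multiplicative characters of the field in question, extended by the value $0$ at $0$ (also for the trivial character). Let $\phi$ be the quadratic character of $\mathbb{F}_q$, and let $M_8$ be a character of $\mathbb{F}_{q^2}$ of order exactly $8$. For a character $C$ of $\mathbb{F}_q$, let $CN$ denote the character $z\mapsto C(N(z))$ of $\mathbb{F}_{q^2}$, and for characters $\alpha,\beta$ of $\mathbb{F}_{q^2}$ let $J_2(\alpha,\beta)=\sum_{z\in\mathbb{F}_{q^2}}\alpha(z)\beta(1-z)$ be the Jacobi sum. Then for every character $\nu$ of $\mathbb{F}_q$, $$\sum_{j,x\in\mathbb{F}_q^*}\phi(j)\,\nu(j)^4\,\phi(x)\,\phi(1-x)\,\phi\bigl(x(j+1)^2+(j-1)^2\bigr)=J_2(\nu N\cdot M_8,\ \phi N)+J_2(\nu N\cdot M_8^5,\ \phi N).$$ -/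

import Mathlib

/-- The quadratic character `φ` of a finite field `F`, with values in `ℂ` (and `φ 0 = 0`). -/
noncomputable def quadChar (F : Type*) [Field F] [Fintype F] [DecidableEq F] : MulChar F ℂ :=
  (quadraticChar F).ringHomComp (Int.castRingHom ℂ)

/-- The character `C N` on `K`: the composition of the character `C` on `F` with the norm map
`N : K → F` of the extension `K / F`. -/
noncomputable def MulChar.compNorm {F : Type*} (K : Type*) [Field F] [Field K] [Finite K]
    [Algebra F K] (C : MulChar F ℂ) : MulChar K ℂ where
  toMonoidHom := C.toMonoidHom.comp (Algebra.norm F : K →* F)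
  map_nonunit' := by
    intro z hz
    have hz0 : z = 0 := by
      by_contra h
      exact hz (isUnit_iff_ne_zero.mpr h)
    subst hz0
    have h0 : Algebra.norm F (0 : K) = 0 := Algebra.norm_zero
    change C (Algebra.norm F (0 : K)) = 0
    rw [h0]
    exact C.map_nonunit not_isUnit_zero

/-!
Write `φ` for the quadratic character of `F` and `ψ = M₈ ^ 2`, so that `ψ ^ 2 = M₈ ^ 4 = φ N` is the
quadratic character of `K`. Since `1 + φ N(z)` counts the square roots of `z`, the two Jacobi sums
add up to `S = ∑ w, (ν N)(w) ^ 2 ψ(w) φ(N(1 - w ^ 2))`. As `q ≡ 3 mod 4`, the Frobenius substitution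
`w ↦ w ^ q` turns `ψ` into `ψ ^ 3 = ψ · φ N`; hence `2 S` is the same sum weighted by `1 + φ(N w)`,
which counts the `j` with `j ^ 2 = N w`. Writing `w = j v` with `N v = 1`, the factor `ψ` depends
only on `v`, and `v = (1 + v) / (1 + v) ^ q` gives `ψ(v) = φ(N(1 + v)) = φ(2 + Tr v)` unless
`v = -1`. So the sum over the norm-one circle is a sum over the trace `t`, which the substitution
`2 + t = (j + 1) ^ 2 x / j` turns into the cubic sum over `x`.
-/

section Units

lemma eq_of_orderOf_eq_two {M R : Type*} [CommMonoid M] [IsCyclic Mˣ] [CommRing R] [IsDomain R]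
    {χ χ' : MulChar M R} (hχ : orderOf χ = 2) (hχ' : orderOf χ' = 2) : χ = χ' := by
  obtain ⟨g, hg⟩ := IsCyclic.exists_generator (α := Mˣ)
  have apply_generator {η : MulChar M R} (hη : orderOf η = 2) : η g = -1 := by
    obtain ⟨hη_sq, hη_ne⟩ := orderOf_eq_prime_iff.mp hη
    have hsq : η g ^ 2 = 1 := by rw [← MulChar.pow_apply_coe, hη_sq, MulChar.one_apply_coe]
    refine (sq_eq_one_iff.mp hsq).resolve_left fun h => hη_ne ?_
    rw [MulChar.eq_iff hg, h, MulChar.one_apply_coe]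
  rw [MulChar.eq_iff hg, apply_generator hχ, apply_generator hχ']

lemma sum_units_eq_sum {G M : Type*} [GroupWithZero G] [Fintype G] [Fintype Gˣ]
    [AddCommMonoid M] {g : G → M} (h0 : g 0 = 0) : ∑ u : Gˣ, g u = ∑ x, g x := by
  refine Fintype.sum_of_injective _ Units.val_injective _ _ (fun x hx => ?_) fun _ => rfl
  by_contra hgx
  exact hx ⟨Units.mk0 x fun hx0 => hgx (by rw [hx0, h0]), rfl⟩

end Units

section QuadChar

variable {F : Type*} [Field F] [Fintype F]

lemma ringChar_ne_two_of_card_mod_four (hq : Fintype.card F % 4 = 3) : ringChar F ≠ 2 := by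
  rw [Ne, FiniteField.even_card_iff_char_two]
  omega

variable [DecidableEq F]

lemma quadChar_sq_apply {a : F} (ha : a ≠ 0) : quadChar F a ^ 2 = 1 := by
  simp only [quadChar, MulChar.ringHomComp_apply, ← map_pow, quadraticChar_sq_one' ha, map_one]

lemma quadChar_apply_sq {a : F} (ha : a ≠ 0) : quadChar F (a ^ 2) = 1 := by
  rw [map_pow, quadChar_sq_apply ha]

lemma quadChar_isQuadratic : (quadChar F).IsQuadratic :=
  (quadraticChar_isQuadratic F).comp _

lemma orderOf_quadChar (hF : ringChar F ≠ 2) : orderOf (quadChar F) = 2 :=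
  orderOf_eq_prime quadChar_isQuadratic.sq_eq_one
    ((MulChar.ringHomComp_ne_one_iff Int.cast_injective).mpr (quadraticChar_ne_one hF))

lemma quadChar_ne_one (hF : ringChar F ≠ 2) : quadChar F ≠ 1 := by
  rw [Ne, ← orderOf_eq_one_iff, orderOf_quadChar hF]
  norm_num

lemma quadChar_four (hF : ringChar F ≠ 2) : quadChar F 4 = 1 := by
  rw [show (4 : F) = 2 ^ 2 by norm_num, quadChar_apply_sq (Ring.two_ne_zero hF)]

lemma card_sq_eq (hF : ringChar F ≠ 2) (a : F) :
    (Finset.card {x : F | x ^ 2 = a} : ℂ) = 1 + quadChar F a := by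
  have h := congrArg (Int.cast : ℤ → ℂ) (quadraticChar_card_sqrts hF a)
  rw [Set.toFinset_ofPred] at h
  simpa [quadChar, add_comm] using h

lemma jacobiSum_add_jacobiSum_mul_quadChar (hF : ringChar F ≠ 2) (χ η : MulChar F ℂ) :
    jacobiSum χ η + jacobiSum (χ * quadChar F) η = ∑ w, (χ ^ 2) w * η (1 - w ^ 2) := by
  calc jacobiSum χ η + jacobiSum (χ * quadChar F) η
    _ = ∑ z, (1 + quadChar F z) * (χ z * η (1 - z)) := by
      simp only [jacobiSum, MulChar.mul_apply, ← Finset.sum_add_distrib]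
      exact Finset.sum_congr rfl fun z _ => by ring
    _ = ∑ z, ∑ w with w ^ 2 = z, χ (w ^ 2) * η (1 - w ^ 2) := by
      refine Finset.sum_congr rfl fun z _ => ?_
      rw [← card_sq_eq hF, ← nsmul_eq_mul]
      refine (Finset.sum_eq_card_nsmul fun w hw => ?_).symm
      rw [(Finset.mem_filter.mp hw).2]
    _ = ∑ w, (χ ^ 2) w * η (1 - w ^ 2) := by
      simp only [Finset.sum_fiberwise, map_pow, MulChar.pow_apply' χ two_ne_zero]

end QuadChar

section CubicSums

variable {F : Type*} [Field F] [Fintype F] [DecidableEq F]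

lemma quadChar_neg_one (hq : Fintype.card F % 4 = 3) : quadChar F (-1) = -1 := by
  have h : ¬ IsSquare (-1 : F) := fun h => FiniteField.isSquare_neg_one_iff.mp h hq
  simp [quadChar, quadraticChar_neg_one_iff_not_isSquare.mpr h]

lemma sum_quadChar_mul_quadChar_one_sub (hq : Fintype.card F % 4 = 3) :
    ∑ x : F, quadChar F x * quadChar F (1 - x) = 1 := by
  have hF : ringChar F ≠ 2 := ringChar_ne_two_of_card_mod_four hq
  have h := jacobiSum_nontrivial_inv (quadChar_ne_one hF)
  rwa [quadChar_isQuadratic.inv, quadChar_neg_one hq, neg_neg] at h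

lemma sum_quadChar_two_add_mul_quadChar_four_sub_sq (hF : ringChar F ≠ 2) :
    ∑ t : F, quadChar F (2 + t) * quadChar F (4 - t ^ 2) = -1 := by
  have hterm (t : F) : quadChar F (2 + t) * quadChar F (4 - t ^ 2) =
      quadChar F (2 - t) - if t = -2 then 1 else 0 := by
    rw [show 4 - t ^ 2 = (2 + t) * (2 - t) by ring, map_mul, ← mul_assoc, ← sq]
    split_ifs with ht
    · rw [ht, add_neg_cancel, MulChar.map_zero, show (2 : F) - -2 = 4 by ring, quadChar_four hF]
      ring
    · rw [quadChar_sq_apply fun h => ht (by linear_combination h), one_mul, sub_zero]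
  have hsum : ∑ t : F, quadChar F (2 - t) = 0 := by
    rw [← MulChar.sum_eq_zero_of_ne_one (quadChar_ne_one hF)]
    exact (Equiv.subLeft (2 : F)).sum_comp (quadChar F)
  rw [Finset.sum_congr rfl fun t _ => hterm t, Finset.sum_sub_distrib, hsum]
  simp

lemma quadChar_mul_sum_cubic (hq : Fintype.card F % 4 = 3) {j : F} (hj : j ≠ 0) :
    quadChar F j * ∑ x : F, quadChar F x * quadChar F (1 - x) *
        quadChar F (x * (j + 1) ^ 2 + (j - 1) ^ 2) =
      ∑ t : F, quadChar F (2 + t) * quadChar F ((1 + j ^ 2) ^ 2 - (j * t) ^ 2) := by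
  have hF : ringChar F ≠ 2 := ringChar_ne_two_of_card_mod_four hq
  by_cases hj1 : j + 1 = 0
  · obtain rfl : j = -1 := eq_neg_of_add_eq_zero_left hj1
    have hleft (x : F) : x * (-1 + 1) ^ 2 + (-1 - 1) ^ 2 = 4 := by ring
    have hright (t : F) : (1 + (-1) ^ 2) ^ 2 - (-1 * t) ^ 2 = 4 - t ^ 2 := by ring
    simp only [hleft, hright, quadChar_four hF, mul_one, sum_quadChar_mul_quadChar_one_sub hq,
      quadChar_neg_one hq, sum_quadChar_two_add_mul_quadChar_four_sub_sq hF]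
  · -- The substitution `2 + t = (j + 1)² x / j`.
    let e : F ≃ F := (Equiv.mulLeft₀ ((j + 1) ^ 2 / j) (by positivity)).trans (Equiv.subRight 2)
    rw [Finset.mul_sum, ← e.sum_comp fun t => quadChar F (2 + t) * _]
    refine Finset.sum_congr rfl fun x _ => ?_
    have he : e x = (j + 1) ^ 2 / j * x - 2 := rfl
    have hlinear : 2 + e x = ((j + 1) / j) ^ 2 * (j * x) := by
      rw [he]
      field_simp
      ring
    have hquadratic : (1 + j ^ 2) ^ 2 - (j * e x) ^ 2 =
        (j + 1) ^ 2 * ((1 - x) * (x * (j + 1) ^ 2 + (j - 1) ^ 2)) := by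
      rw [he]
      field_simp
      ring
    rw [hlinear, hquadratic, map_mul _ (_ ^ 2), map_mul _ (_ ^ 2),
      quadChar_apply_sq (div_ne_zero hj1 hj), quadChar_apply_sq hj1]
    simp only [map_mul]
    ring

end CubicSums

section CompNorm

variable {F K : Type*} [Field F] [Field K] [Finite K] [Algebra F K]

lemma compNorm_apply (C : MulChar F ℂ) (z : K) : C.compNorm K z = C (Algebra.norm F z) := rfl

lemma compNorm_pow (C : MulChar F ℂ) (n : ℕ) : (C ^ n).compNorm K = C.compNorm K ^ n := by
  ext z
  have hz : IsUnit (Algebra.norm F (z : K)) := z.isUnit.map _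
  rw [compNorm_apply, MulChar.pow_apply_coe, compNorm_apply, ← hz.unit_spec,
    MulChar.pow_apply_coe]

lemma orderOf_compNorm (C : MulChar F ℂ) : orderOf (C.compNorm K) = orderOf C := by
  have : Finite F := Finite.of_injective _ (algebraMap F K).injective
  refine orderOf_eq_orderOf_iff.mpr fun n => ?_
  rw [← compNorm_pow, MulChar.eq_one_iff, MulChar.eq_one_iff,
    (FiniteField.unitsMap_norm_surjective F K).forall]
  rfl

end CompNorm

section RankTwo

variable {R S : Type*} [CommRing R] [CommRing S] [Algebra R S] [Module.Free R S]

lemma norm_smul_of_finrank_eq_two (h : Module.finrank R S = 2) (c : R) (z : S) :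
    Algebra.norm R (c • z) = c ^ 2 * Algebra.norm R z := by
  rw [Algebra.smul_def, map_mul, Algebra.norm_algebraMap, h]

variable [Nontrivial R]

lemma norm_one_add_of_finrank_eq_two (h : Module.finrank R S = 2) (z : S) :
    Algebra.norm R (1 + z) = 1 + Algebra.trace R S z + Algebra.norm R z := by
  have : Module.Finite R S := Module.finite_of_finrank_pos (by omega)
  let b : Module.Basis (Fin 2) R S := Module.finBasisOfFinrankEq R S h
  simp only [Algebra.norm_eq_matrix_det b, Algebra.trace_eq_matrix_trace b, map_add, map_one,
    Matrix.det_fin_two, Matrix.trace_fin_two, Matrix.add_apply, Matrix.one_apply_eq,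
    Matrix.one_apply_ne (zero_ne_one (α := Fin 2)), Matrix.one_apply_ne (one_ne_zero (α := Fin 2))]
  ring

lemma norm_one_sub_sq_of_finrank_eq_two (h : Module.finrank R S = 2) (z : S) :
    Algebra.norm R (1 - z ^ 2) = (1 + Algebra.norm R z) ^ 2 - Algebra.trace R S z ^ 2 := by
  have hneg : Algebra.norm R (-z) = Algebra.norm R z := by
    simpa using norm_smul_of_finrank_eq_two h (-1) z
  rw [show 1 - z ^ 2 = (1 + z) * (1 + -z) by ring, map_mul, norm_one_add_of_finrank_eq_two h,
    norm_one_add_of_finrank_eq_two h, hneg, map_neg]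
  ring

end RankTwo

section QuadraticExtension

variable {F K : Type*} [Field F] [Fintype F] [Field K] [Algebra F K]

lemma one_add_pow_card (z : K) : (1 + z) ^ Fintype.card F = 1 + z ^ Fintype.card F := by
  simpa using map_add (FiniteField.frobeniusAlgHom F K) 1 z

lemma one_sub_pow_card (z : K) : (1 - z) ^ Fintype.card F = 1 - z ^ Fintype.card F := by
  simpa using map_sub (FiniteField.frobeniusAlgHom F K) 1 z

lemma norm_pow_card (z : K) : Algebra.norm F (z ^ Fintype.card F) = Algebra.norm F z := by
  rw [map_pow, FiniteField.pow_card]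

lemma algebraMap_norm_of_finrank_eq_two [Finite K] (hK : Module.finrank F K = 2) (z : K) :
    algebraMap F K (Algebra.norm F z) = z * z ^ Fintype.card F := by
  simp [FiniteField.algebraMap_norm_eq_prod_pow, hK, Finset.prod_range_succ]

lemma algebraMap_trace_of_finrank_eq_two [Finite K] (hK : Module.finrank F K = 2) (z : K) :
    algebraMap F K (Algebra.trace F K z) = z + z ^ Fintype.card F := by
  simp [FiniteField.algebraMap_trace_eq_sum_pow, hK, Finset.sum_range_succ]

lemma exists_sq_eq_neg_one_and_pow_card_eq_neg [Finite K] (hq : Fintype.card F % 4 = 3)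
    (hK : Module.finrank F K = 2) : ∃ i : K, i ^ 2 = -1 ∧ i ^ Fintype.card F = -i := by
  have := Fintype.ofFinite K
  have hcard : Fintype.card K = Fintype.card F ^ 2 := by
    rw [Module.card_eq_pow_finrank (K := F), hK]
  obtain ⟨i, hi⟩ : IsSquare (-1 : K) := by
    rw [FiniteField.isSquare_neg_one_iff, hcard, Nat.pow_mod, hq]
    norm_num
  have hi_sq : i ^ 2 = -1 := by rw [sq, ← hi]
  obtain ⟨k, hk⟩ : ∃ k, Fintype.card F = 2 * (2 * k + 1) + 1 := ⟨Fintype.card F / 4, by omega⟩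
  refine ⟨i, hi_sq, ?_⟩
  rw [hk, pow_succ, pow_mul, hi_sq, (odd_two_mul_add_one k).neg_one_pow, neg_one_mul]

lemma exists_equiv_trace_norm [Finite K] (hq : Fintype.card F % 4 = 3)
    (hK : Module.finrank F K = 2) :
    ∃ e : K ≃ F × F, ∀ z, (e z).1 = Algebra.trace F K z ∧
      (e z).1 ^ 2 + (e z).2 ^ 2 = 4 * Algebra.norm F z := by
  have := Fintype.ofFinite K
  obtain ⟨i, hi_sq, hi_pow⟩ := exists_sq_eq_neg_one_and_pow_card_eq_neg hq hK
  have hF : ringChar F ≠ 2 := ringChar_ne_two_of_card_mod_four hq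
  have h2 : (2 : K) ≠ 0 := Ring.two_ne_zero (by rwa [← Algebra.ringChar_eq F K])
  -- If `i ^ q = -i`, then `Tr z = z + z ^ q` and `Tr (i z) = i (z - z ^ q)`.
  let f (z : K) : F × F := (Algebra.trace F K z, Algebra.trace F K (i * z))
  have trace_sub_mul_trace (z : K) :
      algebraMap F K (f z).1 - i * algebraMap F K (f z).2 = 2 * z := by
    simp only [f, algebraMap_trace_of_finrank_eq_two hK, mul_pow, hi_pow]
    linear_combination (z ^ Fintype.card F - z) * hi_sq
  have hf : Function.Injective f := fun z w hzw =>
    mul_left_cancel₀ h2 (by rw [← trace_sub_mul_trace, ← trace_sub_mul_trace, hzw])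
  have hcard : Fintype.card K = Fintype.card (F × F) := by
    rw [Module.card_eq_pow_finrank (K := F), hK, Fintype.card_prod, sq]
  refine ⟨.ofBijective f ((Fintype.bijective_iff_injective_and_card f).mpr ⟨hf, hcard⟩),
    fun z => ⟨rfl, (algebraMap F K).injective ?_⟩⟩
  simp only [Equiv.ofBijective_apply, f, map_add, map_pow, map_mul, map_ofNat,
    algebraMap_trace_of_finrank_eq_two hK, algebraMap_norm_of_finrank_eq_two hK, mul_pow, hi_pow]
  linear_combination (z - z ^ Fintype.card F) ^ 2 * hi_sq

variable [DecidableEq F] [Fintype K]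

lemma sum_comp_trace_of_norm_eq (hq : Fintype.card F % 4 = 3) (hK : Module.finrank F K = 2)
    (n : F) (g : F → ℂ) :
    ∑ z : K with Algebra.norm F z = n, g (Algebra.trace F K z) =
      ∑ t : F, (1 + quadChar F (4 * n - t ^ 2)) * g t := by
  have hF : ringChar F ≠ 2 := ringChar_ne_two_of_card_mod_four hq
  have h4 : (4 : F) ≠ 0 := by
    rw [show (4 : F) = 2 ^ 2 by norm_num]
    exact pow_ne_zero 2 (Ring.two_ne_zero hF)
  obtain ⟨e, he⟩ := exists_equiv_trace_norm (K := K) hq hK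
  calc ∑ z : K with Algebra.norm F z = n, g (Algebra.trace F K z)
    _ = ∑ p : F × F, if p.1 ^ 2 + p.2 ^ 2 = 4 * n then g p.1 else 0 := by
      rw [Finset.sum_filter, ← e.sum_comp]
      refine Finset.sum_congr rfl fun z _ => ?_
      simp only [(he z).2, mul_right_inj' h4]
      rw [(he z).1]
    _ = ∑ t : F, ∑ s : F with s ^ 2 = 4 * n - t ^ 2, g t := by
      simp only [Fintype.sum_prod_type, Finset.sum_filter, eq_sub_iff_add_eq']
    _ = ∑ t : F, (1 + quadChar F (4 * n - t ^ 2)) * g t := by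
      simp only [Finset.sum_const, nsmul_eq_mul, card_sq_eq hF]

lemma sum_mul_one_add_quadChar_norm (hF : ringChar F ≠ 2) (hK : Module.finrank F K = 2)
    {f : K → ℂ} (hf : f 0 = 0) :
    ∑ w : K, f w * (1 + quadChar F (Algebra.norm F w)) =
      ∑ j : Fˣ, ∑ v : K with Algebra.norm F v = 1, f ((j : F) • v) := by
  have : FiniteDimensional F K := .of_finite
  calc ∑ w : K, f w * (1 + quadChar F (Algebra.norm F w))
    _ = ∑ w : K, ∑ j : F with j ^ 2 = Algebra.norm F w, f w := by
      simp only [Finset.sum_const, nsmul_eq_mul, card_sq_eq hF, mul_comm]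
    _ = ∑ j : F, ∑ w : K with j ^ 2 = Algebra.norm F w, f w := by
      simp only [Finset.sum_filter]
      exact Finset.sum_comm
    _ = ∑ j : Fˣ, ∑ w : K with (j : F) ^ 2 = Algebra.norm F w, f w := by
      refine (sum_units_eq_sum (Finset.sum_eq_zero fun w hw => ?_)).symm
      have hw0 : Algebra.norm F w = 0 := by simpa using (Finset.mem_filter.mp hw).2.symm
      rw [Algebra.norm_eq_zero_iff.mp hw0, hf]
    _ = ∑ j : Fˣ, ∑ v : K with Algebra.norm F v = 1, f ((j : F) • v) := by
      refine Finset.sum_congr rfl fun j _ => ?_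
      refine (Finset.sum_equiv (MulAction.toPerm j) (fun v => ?_) fun _ _ => rfl).symm
      simp [Units.smul_def, norm_smul_of_finrank_eq_two hK]

end QuadraticExtension

section QuarticCharacter

variable {F K : Type*} [Field F] [Fintype F] [DecidableEq F] [Field K] [Finite K] [Algebra F K]
  {ψ : MulChar K ℂ}

lemma quartic_apply_pow_card (hq : Fintype.card F % 4 = 3)
    (hψ : ψ ^ 2 = (quadChar F).compNorm K) (z : K) :
    ψ (z ^ Fintype.card F) = ψ z * quadChar F (Algebra.norm F z) := by
  obtain ⟨k, hk⟩ : ∃ k, Fintype.card F = 4 * k + 3 := ⟨Fintype.card F / 4, by omega⟩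
  have hψ4 : ψ ^ 4 = 1 := by
    rw [pow_mul ψ 2 2, hψ, ← compNorm_pow, quadChar_isQuadratic.sq_eq_one,
      ← orderOf_eq_one_iff, orderOf_compNorm, orderOf_one]
  have hpow : ψ ^ Fintype.card F = ψ * (quadChar F).compNorm K := by
    rw [hk, pow_add, pow_mul, hψ4, one_pow, one_mul, pow_succ', hψ]
  rw [map_pow, ← MulChar.pow_apply' ψ Fintype.card_ne_zero, hpow, MulChar.mul_apply,
    compNorm_apply]

lemma quartic_apply_algebraMap (hq : Fintype.card F % 4 = 3) (hK : Module.finrank F K = 2)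
    (hψ : ψ ^ 2 = (quadChar F).compNorm K) {c : F} (hc : c ≠ 0) : ψ (algebraMap F K c) = 1 := by
  obtain ⟨z, rfl⟩ := FiniteField.norm_surjective F K c
  rw [algebraMap_norm_of_finrank_eq_two hK, map_mul, quartic_apply_pow_card hq hψ, ← mul_assoc,
    ← sq, ← MulChar.pow_apply' ψ two_ne_zero, hψ, compNorm_apply, ← sq, quadChar_sq_apply hc]

lemma quartic_apply_of_norm_eq_one (hq : Fintype.card F % 4 = 3) (hK : Module.finrank F K = 2)
    (hψ : ψ ^ 2 = (quadChar F).compNorm K) {v : K} (hv : Algebra.norm F v = 1) (hv1 : 1 + v ≠ 0) :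
    ψ v = quadChar F (Algebra.norm F (1 + v)) := by
  have : FiniteDimensional F K := .of_finite
  have hN : Algebra.norm F (1 + v) ≠ 0 := Algebra.norm_ne_zero_iff.mpr hv1
  have hquot : v * (1 + v) ^ Fintype.card F = 1 + v := by
    rw [one_add_pow_card, mul_add, ← algebraMap_norm_of_finrank_eq_two hK, hv, map_one, mul_one,
      add_comm]
  have hψv : ψ v * quadChar F (Algebra.norm F (1 + v)) = 1 := by
    apply mul_left_cancel₀ ((hv1.isUnit.map ψ).ne_zero)
    rw [mul_left_comm, ← quartic_apply_pow_card hq hψ, ← map_mul, hquot, mul_one]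
  linear_combination quadChar F (Algebra.norm F (1 + v)) * hψv - ψ v * quadChar_sq_apply hN

lemma quartic_apply_of_norm_eq_one_eq_ite (hq : Fintype.card F % 4 = 3)
    (hK : Module.finrank F K = 2) (hψ : ψ ^ 2 = (quadChar F).compNorm K) {v : K}
    (hv : Algebra.norm F v = 1) :
    ψ v = if Algebra.trace F K v = -2 then 1 else quadChar F (2 + Algebra.trace F K v) := by
  have : FiniteDimensional F K := .of_finite
  have hN : Algebra.norm F (1 + v) = 2 + Algebra.trace F K v := by
    rw [norm_one_add_of_finrank_eq_two hK, hv]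
    ring
  split_ifs with ht
  · have hv0 : 1 + v = 0 := by
      rw [← Algebra.norm_eq_zero_iff (R := F), hN, ht, add_neg_cancel]
    rw [← neg_eq_of_add_eq_zero_right hv0, ← map_one (algebraMap F K), ← map_neg,
      quartic_apply_algebraMap hq hK hψ (neg_ne_zero.mpr one_ne_zero)]
  · rw [quartic_apply_of_norm_eq_one hq hK hψ hv, hN]
    intro hv0
    rw [hv0, Algebra.norm_zero] at hN
    exact ht (by linear_combination -hN)

end QuarticCharacter

section QuarticSums

variable {F K : Type*} [Field F] [Fintype F] [DecidableEq F] [Field K] [Fintype K] [Algebra F K]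
  {ψ : MulChar K ℂ}

lemma sum_quartic_mul_comp_trace_of_norm_eq_one (hq : Fintype.card F % 4 = 3)
    (hK : Module.finrank F K = 2) (hψ : ψ ^ 2 = (quadChar F).compNorm K) (g : F → ℂ) :
    ∑ v : K with Algebra.norm F v = 1, ψ v * g (Algebra.trace F K v) =
      ∑ t : F, (quadChar F (2 + t) + quadChar F (2 - t)) * g t := by
  have hF : ringChar F ≠ 2 := ringChar_ne_two_of_card_mod_four hq
  rw [Finset.sum_congr rfl fun v hv => by
      rw [quartic_apply_of_norm_eq_one_eq_ite hq hK hψ (Finset.mem_filter.mp hv).2],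
    sum_comp_trace_of_norm_eq hq hK 1 fun t => (if t = -2 then 1 else quadChar F (2 + t)) * g t]
  refine Finset.sum_congr rfl fun t _ => ?_
  rw [← mul_assoc]
  congr 1
  split_ifs with ht
  · subst ht
    norm_num [quadChar_four hF, MulChar.map_zero]
  · have hsq := quadChar_sq_apply fun h : 2 + t = 0 => ht (by linear_combination h)
    rw [show 4 * 1 - t ^ 2 = (2 + t) * (2 - t) by ring, map_mul]
    linear_combination quadChar F (2 - t) * hsq

lemma sum_quartic_mul_quadChar_norm_one_sub_sq (hq : Fintype.card F % 4 = 3)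
    (hK : Module.finrank F K = 2) (hψ : ψ ^ 2 = (quadChar F).compNorm K) (j : F) :
    ∑ v : K with Algebra.norm F v = 1,
        ψ v * quadChar F (Algebra.norm F (1 - (j • v) ^ 2)) =
      2 * ∑ t : F, quadChar F (2 + t) * quadChar F ((1 + j ^ 2) ^ 2 - (j * t) ^ 2) := by
  let g (t : F) : ℂ := quadChar F ((1 + j ^ 2) ^ 2 - (j * t) ^ 2)
  have hg (t : F) : g (-t) = g t := by simp only [g, mul_neg, neg_sq]
  have hreflect : ∑ t, quadChar F (2 - t) * g t = ∑ t, quadChar F (2 + t) * g t :=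
    Fintype.sum_equiv (Equiv.neg F) _ _ fun t => by
      rw [Equiv.neg_apply, hg, sub_eq_add_neg]
  have hterm : ∀ v ∈ ({v | Algebra.norm F v = 1} : Finset K),
      ψ v * quadChar F (Algebra.norm F (1 - (j • v) ^ 2)) = ψ v * g (Algebra.trace F K v) := by
    intro v hv
    rw [norm_one_sub_sq_of_finrank_eq_two hK, norm_smul_of_finrank_eq_two hK,
      (Finset.mem_filter.mp hv).2, map_smul, smul_eq_mul, mul_one]
  rw [Finset.sum_congr rfl hterm, sum_quartic_mul_comp_trace_of_norm_eq_one hq hK hψ]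
  simp only [add_mul, Finset.sum_add_distrib, hreflect, two_mul, g]

lemma sum_compNorm_mul_quartic_mul_quadChar_norm (hq : Fintype.card F % 4 = 3)
    (hψ : ψ ^ 2 = (quadChar F).compNorm K) (C : MulChar F ℂ) :
    ∑ w : K, (C.compNorm K * ψ) w * (quadChar F).compNorm K (1 - w ^ 2) *
        quadChar F (Algebra.norm F w) =
      ∑ w : K, (C.compNorm K * ψ) w * (quadChar F).compNorm K (1 - w ^ 2) := by
  have hfrob : Function.Bijective fun w : K => w ^ Fintype.card F :=
    Finite.injective_iff_bijective.mp (FiniteField.frobeniusAlgHom F K).injective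
  rw [← hfrob.sum_comp fun w : K => (C.compNorm K * ψ) w * (quadChar F).compNorm K (1 - w ^ 2)]
  refine Finset.sum_congr rfl fun w _ => ?_
  simp only [MulChar.mul_apply, compNorm_apply, quartic_apply_pow_card hq hψ, norm_pow_card,
    pow_right_comm w _ 2, ← one_sub_pow_card]
  ring

lemma sum_compNorm_mul_quartic (hq : Fintype.card F % 4 = 3) (hK : Module.finrank F K = 2)
    (hψ : ψ ^ 2 = (quadChar F).compNorm K) (C : MulChar F ℂ) :
    ∑ w : K, (C.compNorm K * ψ) w * (quadChar F).compNorm K (1 - w ^ 2) =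
      ∑ j : Fˣ, C (j ^ 2) *
        ∑ t : F, quadChar F (2 + t) * quadChar F ((1 + j ^ 2) ^ 2 - (j * t) ^ 2) := by
  have hF : ringChar F ≠ 2 := ringChar_ne_two_of_card_mod_four hq
  let f (w : K) : ℂ := (C.compNorm K * ψ) w * (quadChar F).compNorm K (1 - w ^ 2)
  have hf : f 0 = 0 := by simp only [f, MulChar.map_zero, zero_mul]
  have hcircle (j : Fˣ) : ∑ v : K with Algebra.norm F v = 1, f ((j : F) • v) =
      2 * (C (j ^ 2) *
        ∑ t : F, quadChar F (2 + t) * quadChar F ((1 + j ^ 2) ^ 2 - (j * t) ^ 2)) := by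
    rw [mul_left_comm, ← sum_quartic_mul_quadChar_norm_one_sub_sq hq hK hψ, Finset.mul_sum]
    refine Finset.sum_congr rfl fun v hv => ?_
    have hψj : ψ ((j : F) • v) = ψ v := by
      rw [Algebra.smul_def, map_mul, quartic_apply_algebraMap hq hK hψ j.ne_zero, one_mul]
    simp only [f, MulChar.mul_apply, compNorm_apply, hψj, norm_smul_of_finrank_eq_two hK,
      (Finset.mem_filter.mp hv).2, mul_one, mul_assoc]
  apply mul_left_cancel₀ (two_ne_zero (α := ℂ))
  calc 2 * ∑ w, f w
    _ = ∑ w, f w * (1 + quadChar F (Algebra.norm F w)) := by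
      simp only [mul_one_add, Finset.sum_add_distrib, f,
        sum_compNorm_mul_quartic_mul_quadChar_norm hq hψ, two_mul]
    _ = _ := by
      rw [sum_mul_one_add_quadChar_norm hF hK hf, Finset.mul_sum]
      exact Finset.sum_congr rfl fun j _ => hcircle j

end QuarticSums

theorem theorem5p4 {F K : Type*} [Field F] [Fintype F] [DecidableEq F] [Field K] [Fintype K]
    [Algebra F K] (hq : Fintype.card F % 4 = 3) (hK : Module.finrank F K = 2)
    (M₈ : MulChar K ℂ) (hM₈ : orderOf M₈ = 8) (ν : MulChar F ℂ) :
    ∑ j : Fˣ, ∑ x : Fˣ,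
        (quadChar F * ν ^ 4) (j : F) * quadChar F (x : F) * quadChar F (1 - (x : F)) *
          quadChar F ((x : F) * ((j : F) + 1) ^ 2 + ((j : F) - 1) ^ 2) =
      jacobiSum (ν.compNorm K * M₈) ((quadChar F).compNorm K) +
        jacobiSum (ν.compNorm K * M₈ ^ 5) ((quadChar F).compNorm K) := by
  classical
  have hF : ringChar F ≠ 2 := ringChar_ne_two_of_card_mod_four hq
  have hKchar : ringChar K ≠ 2 := by rwa [← Algebra.ringChar_eq F K]
  have hM₈_four : M₈ ^ 4 = quadChar K := eq_of_orderOf_eq_two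
    (by rw [orderOf_pow, hM₈]; norm_num) (orderOf_quadChar hKchar)
  have hφN : quadChar K = (quadChar F).compNorm K := eq_of_orderOf_eq_two
    (orderOf_quadChar hKchar) (by rw [orderOf_compNorm, orderOf_quadChar hF])
  have hψ : (M₈ ^ 2) ^ 2 = (quadChar F).compNorm K := by rw [← pow_mul, hM₈_four, hφN]
  calc
    _ = ∑ j : Fˣ, (ν ^ 2) (j ^ 2) *
        ∑ t : F, quadChar F (2 + t) * quadChar F ((1 + j ^ 2) ^ 2 - (j * t) ^ 2) := by
      refine Finset.sum_congr rfl fun j _ => ?_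
      rw [← quadChar_mul_sum_cubic hq j.ne_zero,
        ← sum_units_eq_sum (G := F) (by simp [MulChar.map_zero]), Finset.mul_sum, Finset.mul_sum]
      refine Finset.sum_congr rfl fun x _ => ?_
      simp only [MulChar.mul_apply, MulChar.pow_apply_coe, map_pow]
      ring
    _ = ∑ w : K, ((ν.compNorm K * M₈) ^ 2) w * (quadChar F).compNorm K (1 - w ^ 2) := by
      rw [mul_pow, ← compNorm_pow, sum_compNorm_mul_quartic hq hK hψ]
    _ = _ := by
      rw [← jacobiSum_add_jacobiSum_mul_quadChar hKchar, ← hM₈_four, mul_assoc, ← pow_succ']
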